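/- There are universal constants $C>0$ and $c\in\mathbb N$ such that the following holds. Let $X$ be a measurable space, $\gamma\ge 1$, $\tau>0$, $k\ge 1$ an integer, and let $\mathcal D$ be a $\gamma$-flat class of probability distributions on $X$, i.e. there is a probability distribution $\bar D$ on $X$ with $D(E)\le\gamma\,\bar D(E)$ for all $D\in\mathcal D$ and all measurable $E\subseteq X$. For a distribution $D$ on $X$, let $D^k[\phi]$ denote the expectation of $\phi(x_1,\dots,x_k)$ for $x_1,\dots,x_k$ drawn independently from $D$, and let $\mathsf{STAT}^{(1)}_D(\tau')$ denote any oracle that answers each (measurable) query $\psi:X\to[-1,1]$ with some value $v$ satisfying $|v-D[\psi]|\le\tau'$; the answer may depend on the earlier queries and answers. Then there is a randomized algorithm that, given any $\delta>0$ and any (measurable) $\phi:X^k\to[-1,1]$, asks at most $$C\cdot F\cdot\max\{1,\log(1/\delta)\}\cdot\bigl(\log(2+F)\bigr)^{c},\qquad F=\frac{\gamma^{k-1}k^3}{\tau^3},$$ queries and, for every (unknown) $D\in\mathcal D$ and every oracle $\mathsf{STAT}^{(1)}_D(\tau/(6k))$ answering its queries, outputs with probability at least $1-\delta$ a value within $\tau$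 of $D^k[\phi]$. In other words, the number of queries is $\tilde O\bigl(\gamma^{k-1}k^3\tau^{-3}\log(1/\delta)\bigr)$. -/

import Mathlib

open MeasureTheory

universe u

namespace SQ

/-- A class `𝒟` of probability distributions on `X` is `γ`-flat if some probability distribution
`Dbar` satisfies `D(E) ≤ γ * Dbar(E)` for all `D ∈ 𝒟` and all measurable `E`. -/
def IsFlat {X : Type u} [MeasurableSpace X] (γ : ℝ) (𝒟 : Set (ProbabilityMeasure X)) : Prop :=
  ∃ Dbar : ProbabilityMeasure X, ∀ D ∈ 𝒟, ∀ E : Set X, MeasurableSet E →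
    (D : Measure X).real E ≤ γ * (Dbar : Measure X).real E

/-- A `k`-ary query function `X^k → [-1, 1]` (measurable, so that its expectation makes sense). -/
structure Query (X : Type u) [MeasurableSpace X] (k : ℕ) where
  toFun : (Fin k → X) → ℝ
  measurable : Measurable toFun
  mem_Icc : ∀ x, toFun x ∈ Set.Icc (-1 : ℝ) 1

/-- The expectation `D^k[φ]` of `φ` on `k` independent samples from `D`. -/
noncomputable def Query.mean {X : Type u} [MeasurableSpace X] {k : ℕ} (φ : Query X k)
    (D : ProbabilityMeasure X) : ℝ :=
  ∫ x, φ.toFun x ∂(Measure.pi fun _ : Fin k => (D : Measure X))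

/-- An oracle for `k`-ary queries. It sees the past queries and its past answers (most recent
first) together with the current query, and it may choose its answer adaptively. -/
abbrev Oracle (X : Type u) [MeasurableSpace X] (k : ℕ) : Type u :=
  List (Query X k × ℝ) → Query X k → ℝ

/-- `O` is a valid `k`-wise statistical query oracle for `D` with tolerance `τ`. -/
def IsSTAT {X : Type u} [MeasurableSpace X] {k : ℕ} (D : ProbabilityMeasure X) (τ : ℝ)
    (O : Oracle X k) : Prop :=
  ∀ h φ, |O h φ - φ.mean D| ≤ τ

/-- Randomized algorithms with real output and access to an oracle for `k`-ary queries, as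
interaction trees: at each step the algorithm stops with an output, draws a random number
(independently of everything before, from a distribution of its choice), or asks a query
and continues according to the answer. -/
inductive Algorithm (X : Type u) [MeasurableSpace X] (k : ℕ) : Type u
  | output (r : ℝ) : Algorithm X k
  | draw (p : PMF ℕ) (next : ℕ → Algorithm X k) : Algorithm X k
  | ask (φ : Query X k) (next : ℝ → Algorithm X k) : Algorithm X k

namespace Algorithm

/-- The distribution of the output when the queries are answered by `O`, started after the
exchange `h` with the oracle. -/
noncomputable def run {X : Type u} [MeasurableSpace X] {k : ℕ} (O : Oracle X k) :
    Algorithm X k → List (Query X k × ℝ) → PMF ℝ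
  | output r, _ => PMF.pure r
  | draw p next, h => p.bind fun i => run O (next i) h
  | ask φ next, h => run O (next (O h φ)) ((φ, O h φ) :: h)

/-- The algorithm asks at most `q` queries, whatever the random draws and the answers are. -/
def AsksAtMost {X : Type u} [MeasurableSpace X] {k : ℕ} : Algorithm X k → ℕ → Prop
  | output _, _ => True
  | draw _ next, q => ∀ i, AsksAtMost (next i) q
  | ask _ _, 0 => False
  | ask _ next, q + 1 => ∀ v, AsksAtMost (next v) q

/-- With probability at least `1 - δ` the output is within `τ` of `a`, when the queries are
answered by `O`. -/
def Estimates {X : Type u} [MeasurableSpace X] {k : ℕ} (A : Algorithm X k) (O : Oracle X k)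
    (a τ δ : ℝ) : Prop :=
  ENNReal.ofReal (1 - δ) ≤ (A.run O []).toOuterMeasure {r | |r - a| ≤ τ}

end Algorithm

end SQ

/-!
Approximate `φ` in mean under the reference distribution by a function of the cells, in a finite
measurable partition of `X`, that contain the samples. Flatness bounds the error under `D ^ k` by
`γ ^ k` times that error, so the unknown distribution becomes a weight vector `p ≤ γ • q` on a
finite set, with `q` known.

Start multiplicative weights at `q`. If the product of the current weights `r` has the wrong mean,
then by the hybrid argument a random slice (a unary function obtained by fixing all coordinates but
one, those before it sampled from `r` and those after it from `p`) distinguishes `p` from `r`.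
Sampling the latter from `q` instead loses at most a factor `γ ^ (k - 1)` in probability, so
about `γ ^ (k - 1) * k / τ` random slices suffice to find one that distinguishes. Updating the
weights along it decreases the divergence from `p`, initially at most `log γ`, by a constant
multiple of `(τ / k) ^ 2`. Hence there are at most about `(k / τ) ^ 2 * log γ` updates.
-/

namespace SQ

section ProductMeasure

variable {κ : Type*} [Fintype κ] {Y : κ → Type*} [∀ i, MeasurableSpace (Y i)]

theorem pi_mono {μ ν : ∀ i, Measure (Y i)} [∀ i, SigmaFinite (μ i)] (h : ∀ i, μ i ≤ ν i) :
    Measure.pi μ ≤ Measure.pi ν := by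
  have houter : (Measure.pi μ).toOuterMeasure ≤
      OuterMeasure.pi fun i => (ν i).toOuterMeasure := by
    refine OuterMeasure.le_pi.2 fun s _ => ?_
    change Measure.pi μ (Set.pi Set.univ s) ≤ ∏ i, ν i (s i)
    rw [Measure.pi_pi]
    exact Finset.prod_le_prod' fun i _ => h i (s i)
  refine Measure.le_iff.2 fun s hs => ?_
  conv_rhs => rw [Measure.pi, toMeasure_apply _ _ hs]
  exact houter s

theorem pi_const_smul (c : NNReal) (ν : ∀ i, Measure (Y i)) [∀ i, SigmaFinite (ν i)] :
    Measure.pi (fun i => c • ν i) = c ^ Fintype.card κ • Measure.pi ν := by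
  refine Measure.pi_eq fun s _ => ?_
  simp only [Measure.smul_apply, Measure.pi_pi, ENNReal.smul_def, smul_eq_mul,
    Finset.prod_mul_distrib, Finset.prod_const, Finset.card_univ, ENNReal.coe_pow]

theorem integral_pi_le_pow_mul {μ ν : ∀ i, Measure (Y i)} [∀ i, SigmaFinite (μ i)]
    [∀ i, SigmaFinite (ν i)] {c : NNReal} (h : ∀ i, μ i ≤ c • ν i) {f : (∀ i, Y i) → ℝ}
    (hf : Integrable f (Measure.pi ν)) (hf0 : 0 ≤ f) :
    ∫ x, f x ∂Measure.pi μ ≤ c ^ Fintype.card κ * ∫ x, f x ∂Measure.pi ν :=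
  calc ∫ x, f x ∂Measure.pi μ
      ≤ ∫ x, f x ∂(c ^ Fintype.card κ • Measure.pi ν) :=
        integral_mono_measure ((pi_mono h).trans_eq (pi_const_smul c ν)) (.of_forall hf0)
          hf.smul_measure_nnreal
    _ = c ^ Fintype.card κ * ∫ x, f x ∂Measure.pi ν := by
        rw [integral_smul_nnreal_measure, NNReal.smul_def, smul_eq_mul, NNReal.coe_pow]

end ProductMeasure

/-- A function on `X^κ` is a grid function if it factors through a finite measurable partition
of `X`, applied to each coordinate. The cells of the partition are the fibres of `π`. -/
def IsGridFunction {X κ β : Type*} [MeasurableSpace X] (f : (κ → X) → β) : Prop :=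
  ∃ (m : ℕ) (π : X → Fin m) (g : (κ → Fin m) → β), Measurable π ∧ f = fun x => g (π ∘ x)

namespace IsGridFunction

variable {X κ β β' β'' : Type*} [MeasurableSpace X]

theorem of_finite {ι : Type*} [Finite ι] [MeasurableSpace ι] [MeasurableSingletonClass ι]
    {π : X → ι} (hπ : Measurable π) (g : (κ → ι) → β) :
    IsGridFunction fun x : κ → X => g (π ∘ x) := by
  refine ⟨Nat.card ι, Finite.equivFin ι ∘ π, fun y => g ((Finite.equivFin ι).symm ∘ y),
    (measurable_of_finite _).comp hπ, ?_⟩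
  simp only [← Function.comp_assoc, Equiv.symm_comp_self, Function.id_comp]

theorem comp {f : (κ → X) → β} (hf : IsGridFunction f) (op : β → β') :
    IsGridFunction fun x => op (f x) := by
  obtain ⟨m, π, g, hπ, rfl⟩ := hf
  exact ⟨m, π, fun y => op (g y), hπ, rfl⟩

theorem comp₂ {f : (κ → X) → β} {f' : (κ → X) → β'} (hf : IsGridFunction f)
    (hf' : IsGridFunction f') (op : β → β' → β'') : IsGridFunction fun x => op (f x) (f' x) := by
  obtain ⟨m, π, g, hπ, rfl⟩ := hf
  obtain ⟨m', π', g', hπ', rfl⟩ := hf'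
  exact of_finite (hπ.prodMk hπ') fun y => op (g fun i => (y i).1) (g' fun i => (y i).2)

theorem isSetAlgebra : IsSetAlgebra {s : Set (κ → X) | IsGridFunction fun x => x ∈ s} where
  empty_mem := of_finite (π := fun _ => ()) measurable_const fun _ => False
  compl_mem _ hs := hs.comp Not
  union_mem _ _ hs ht := hs.comp₂ ht Or

variable [Finite κ]

theorem measurable [MeasurableSpace β] {f : (κ → X) → β} (hf : IsGridFunction f) :
    Measurable f := by
  obtain ⟨m, π, g, hπ, rfl⟩ := hf
  exact (measurable_of_finite g).comp
    (measurable_pi_lambda _ fun i => hπ.comp (measurable_pi_apply i))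

theorem mem_pi {s : κ → Set X} (hs : ∀ i, MeasurableSet (s i)) :
    IsGridFunction fun x : κ → X => x ∈ Set.pi Set.univ s := by
  convert! of_finite (π := fun (x : X) i => x ∈ s i)
    (measurable_pi_lambda _ fun i => measurableSet_setOfPred.1 (hs i)) fun y => ∀ i, y i i using 2
  simp

theorem generateFrom_eq :
    MeasurableSpace.generateFrom {s : Set (κ → X) | IsGridFunction fun x => x ∈ s} =
      MeasurableSpace.pi := by
  apply le_antisymm
  · exact MeasurableSpace.generateFrom_le fun s hs => measurableSet_setOfPred.2 hs.measurable
  · rw [← generateFrom_pi]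
    refine MeasurableSpace.generateFrom_mono ?_
    rintro _ ⟨s, hs, rfl⟩
    exact mem_pi fun i => hs i (Set.mem_univ i)

theorem exists_eLpNorm_sub_le (μ : Measure (κ → X)) [IsFiniteMeasure μ] {f : (κ → X) → ℝ}
    (hf : MemLp f 1 μ) {ε : ENNReal} (hε : ε ≠ 0) :
    ∃ g, eLpNorm (f - g) 1 μ ≤ ε ∧ IsGridFunction g := by
  classical
  refine hf.induction_dense ENNReal.one_ne_top _ ?_ (fun f g hf hg => hf.comp₂ hg (· + ·))
    (fun f hf => hf.measurable.aestronglyMeasurable) hε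
  intro c s hs _ ε hε
  obtain ⟨η, hη, hηε⟩ := exists_eLpNorm_indicator_le (μ := μ) ENNReal.one_ne_top c hε
  obtain ⟨t, ht, hst⟩ := (Measure.MeasureDense.of_generateFrom_isSetAlgebra_finite μ
    isSetAlgebra generateFrom_eq.symm).approx s hs (measure_ne_top _ _) η hη
  refine ⟨t.indicator fun _ => c, ?_, ?_⟩
  · rw [eLpNorm_indicator_sub_indicator, symmDiff_comm]
    exact hηε _ (hst.le.trans_eq (ENNReal.ofReal_coe_nnreal))
  · convert! ht.comp (fun p : Prop => if p then c else 0) using 2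

theorem exists_integral_abs_sub_le (μ : Measure (κ → X)) [IsFiniteMeasure μ] {f : (κ → X) → ℝ}
    (hf : Integrable f μ) {ε : ℝ} (hε : 0 < ε) :
    ∃ g, IsGridFunction g ∧ Integrable g μ ∧ ∫ x, |f x - g x| ∂μ ≤ ε := by
  obtain ⟨g, hfg, hg⟩ :=
    exists_eLpNorm_sub_le μ (memLp_one_iff_integrable.2 hf) (ENNReal.ofReal_pos.2 hε).ne'
  have hsub : Integrable (f - g) μ := memLp_one_iff_integrable.1
    ⟨hf.aestronglyMeasurable.sub hg.measurable.aestronglyMeasurable,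
      hfg.trans_lt ENNReal.ofReal_lt_top⟩
  refine ⟨g, hg, by simpa using hf.sub hsub, ?_⟩
  rw [← ENNReal.ofReal_le_ofReal_iff hε.le]
  refine Eq.trans_le ?_ hfg
  rw [eLpNorm_one_eq_lintegral_enorm]
  exact ofReal_integral_norm_eq_lintegral_enorm hsub

theorem exists_mem_Icc_integral_abs_sub_le (μ : Measure (κ → X)) [IsFiniteMeasure μ]
    {f : (κ → X) → ℝ} (hf : Measurable f) {a b : ℝ} (hab : a ≤ b) (hfab : ∀ x, f x ∈ Set.Icc a b)
    {ε : ℝ} (hε : 0 < ε) :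
    ∃ (m : ℕ) (π : X → Fin m) (g : (κ → Fin m) → ℝ), Measurable π ∧ (∀ y, g y ∈ Set.Icc a b) ∧
      ∫ x, |f x - g (π ∘ x)| ∂μ ≤ ε := by
  have hfi : Integrable f μ := .of_mem_Icc a b hf.aemeasurable (.of_forall hfab)
  obtain ⟨_, ⟨m, π, g, hπ, rfl⟩, hgi, hfg⟩ := exists_integral_abs_sub_le μ hfi hε
  -- Clipping the approximant to the range of `f` does not increase the error.
  refine ⟨m, π, fun y => Set.projIcc a b hab (g y), hπ, fun y => (Set.projIcc a b hab _).2, ?_⟩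
  refine (integral_mono_of_nonneg (.of_forall fun x => abs_nonneg _) (hfi.sub hgi).abs
    (.of_forall fun x => ?_)).trans hfg
  have hclip := Set.abs_projIcc_sub_projIcc hab (c := f x) (d := g (π ∘ x))
  rwa [Set.projIcc_of_mem hab (hfab x)] at hclip

end IsGridFunction

section MultiplicativeWeights

variable {ι : Type*} [Fintype ι] {p q θ f : ι → ℝ}

theorem abs_dotProduct_le_of_mem_stdSimplex (hp : p ∈ stdSimplex ℝ ι) {M : ℝ}
    (hf : ∀ a, |f a| ≤ M) : |p ⬝ᵥ f| ≤ M :=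
  calc |p ⬝ᵥ f| ≤ ∑ a, |p a * f a| := Finset.abs_sum_le_sum_abs _ _
    _ ≤ ∑ a, p a * M := Finset.sum_le_sum fun a _ => by
        rw [abs_mul, abs_of_nonneg (hp.1 a)]
        exact mul_le_mul_of_nonneg_left (hf a) (hp.1 a)
    _ = M := by rw [← Finset.sum_mul, hp.2, one_mul]

theorem dotProduct_le_add_mul_sum_filter (hp : p ∈ stdSimplex ℝ ι) {β M : ℝ}
    (hβ : 0 ≤ β) (hf : ∀ a, f a ≤ M) : p ⬝ᵥ f ≤ β + M * ∑ a with β < f a, p a :=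
  calc p ⬝ᵥ f ≤ ∑ a, (p a * β + M * if β < f a then p a else 0) := by
        refine Finset.sum_le_sum fun a _ => ?_
        have hpa := hp.1 a
        split_ifs with h
        · linarith [mul_le_mul_of_nonneg_left (hf a) hpa, mul_nonneg hpa hβ]
        · linarith [mul_le_mul_of_nonneg_left (not_lt.1 h) hpa]
    _ = β + M * ∑ a with β < f a, p a := by
        rw [Finset.sum_add_distrib, ← Finset.sum_mul, hp.2, one_mul, ← Finset.mul_sum,
          Finset.sum_filter]

/-- The normalizing constant of the exponential tilt of `q` by `θ`. -/
noncomputable def partitionFunction (q θ : ι → ℝ) : ℝ := q ⬝ᵥ fun a => Real.exp (θ a)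

/-- The exponential tilt of `q` by `θ`: the weights that the multiplicative weights method started
at `q` holds after updates that sum up to `θ`. -/
noncomputable def gibbs (q θ : ι → ℝ) : ι → ℝ := fun a =>
  q a * Real.exp (θ a) / partitionFunction q θ

/-- The decrease of the Kullback-Leibler divergence from `p` when `q` is replaced by `gibbs q θ`,
the potential function of the multiplicative weights method. -/
noncomputable def entropyGain (p q θ : ι → ℝ) : ℝ := p ⬝ᵥ θ - Real.log (partitionFunction q θ)

theorem partitionFunction_pos (hq : q ∈ stdSimplex ℝ ι) : 0 < partitionFunction q θ := by
  obtain ⟨a, -, ha⟩ := Finset.exists_ne_zero_of_sum_ne_zero (hq.2.trans_ne one_ne_zero)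
  exact Finset.sum_pos' (fun b _ => mul_nonneg (hq.1 b) (Real.exp_pos _).le)
    ⟨a, Finset.mem_univ a, mul_pos ((hq.1 a).lt_of_ne' ha) (Real.exp_pos _)⟩

theorem gibbs_mem_stdSimplex (hq : q ∈ stdSimplex ℝ ι) : gibbs q θ ∈ stdSimplex ℝ ι := by
  refine ⟨fun a => div_nonneg (mul_nonneg (hq.1 a) (Real.exp_pos _).le)
    (partitionFunction_pos hq).le, ?_⟩
  simp only [gibbs, ← Finset.sum_div]
  exact div_self (partitionFunction_pos hq).ne'

theorem partitionFunction_add (hq : q ∈ stdSimplex ℝ ι) :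
    partitionFunction q (θ + f) =
      partitionFunction q θ * gibbs q θ ⬝ᵥ fun a => Real.exp (f a) := by
  have hZ := (partitionFunction_pos hq (θ := θ)).ne'
  rw [partitionFunction, dotProduct, dotProduct, Finset.mul_sum]
  refine Finset.sum_congr rfl fun a _ => ?_
  rw [gibbs, Pi.add_apply, Real.exp_add]
  field_simp

theorem entropyGain_zero (hq : q ∈ stdSimplex ℝ ι) : entropyGain p q 0 = 0 := by
  simp [entropyGain, partitionFunction, dotProduct, hq.2]

theorem entropyGain_le (hp : p ∈ stdSimplex ℝ ι) {γ : ℝ}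
    (hpq : p ≤ γ • q) : entropyGain p q θ ≤ Real.log γ := by
  have hexp : Real.exp (p ⬝ᵥ θ) ≤ γ * partitionFunction q θ :=
    calc Real.exp (p ⬝ᵥ θ) ≤ p ⬝ᵥ fun a => Real.exp (θ a) :=
          convexOn_exp.map_sum_le (fun a _ => hp.1 a) hp.2 fun _ _ => Set.mem_univ _
      _ ≤ (γ • q) ⬝ᵥ fun a => Real.exp (θ a) :=
          dotProduct_le_dotProduct_of_nonneg_right hpq fun a => (Real.exp_pos _).le
      _ = γ * partitionFunction q θ := smul_dotProduct _ _ _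
  have hpos : 0 < γ * partitionFunction q θ := (Real.exp_pos _).trans_le hexp
  rw [entropyGain, sub_le_iff_le_add, ← Real.log_mul (left_ne_zero_of_mul hpos.ne')
    (right_ne_zero_of_mul hpos.ne')]
  exact (Real.le_log_iff_exp_le hpos).2 hexp

theorem entropyGain_add_ge (hq : q ∈ stdSimplex ℝ ι) {η : ℝ} (hη : η ≤ 1)
    (hf : ∀ a, |f a| ≤ η) :
    entropyGain p q θ + (p - gibbs q θ) ⬝ᵥ f - η ^ 2 ≤ entropyGain p q (θ + f) := by
  have hexp : gibbs q θ ⬝ᵥ (fun a => Real.exp (f a)) ≤ 1 + gibbs q θ ⬝ᵥ f + η ^ 2 := by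
    have hone : gibbs q θ ⬝ᵥ 1 = 1 := by
      rw [dotProduct_one, (gibbs_mem_stdSimplex hq).2]
    have hquad : |gibbs q θ ⬝ᵥ ((fun a => Real.exp (f a)) - 1 - f)| ≤ η ^ 2 :=
      abs_dotProduct_le_of_mem_stdSimplex (gibbs_mem_stdSimplex hq) fun a =>
        (Real.abs_exp_sub_one_sub_id_le ((hf a).trans hη)).trans
          (sq_le_sq' (neg_le_of_abs_le (hf a)) (le_of_abs_le (hf a)))
    rw [dotProduct_sub, dotProduct_sub, hone] at hquad
    linarith [le_of_abs_le hquad]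
  have hpos : 0 < gibbs q θ ⬝ᵥ fun a => Real.exp (f a) :=
    partitionFunction_pos (gibbs_mem_stdSimplex hq)
  have hlog := Real.log_le_sub_one_of_pos hpos
  rw [entropyGain, entropyGain, partitionFunction_add hq,
    Real.log_mul (partitionFunction_pos hq).ne' hpos.ne', dotProduct_add, sub_dotProduct]
  linarith

/-- One step of the multiplicative weights method with rate `α / 2`: tilt further along `f`, in
the direction that moves the mean of `f` towards the value `v`. -/
noncomputable def weightUpdate (q : ι → ℝ) (α : ℝ) (θ f : ι → ℝ) (v : ℝ) : ι → ℝ :=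
  θ + (α / 2 * SignType.sign (v - gibbs q θ ⬝ᵥ f)) • f

theorem le_sign_mul_of_two_mul_lt_abs {x y v α : ℝ} (hvx : |v - x| ≤ α) (hvy : 2 * α < |v - y|) :
    α ≤ SignType.sign (v - y) * (x - y) := by
  obtain ⟨h₁, h₂⟩ := abs_le.1 hvx
  rcases lt_trichotomy (v - y) 0 with h | h | h
  · rw [sign_neg h, abs_of_neg h] at *
    norm_num
    linarith
  · rw [h, abs_zero] at hvy
    linarith
  · rw [sign_pos h, abs_of_pos h] at *
    norm_num
    linarith

theorem entropyGain_weightUpdate (hq : q ∈ stdSimplex ℝ ι) (hf : ∀ a, |f a| ≤ 1) {α v : ℝ}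
    (hα1 : α ≤ 1) (hv : |v - p ⬝ᵥ f| ≤ α) (htest : 2 * α < |v - gibbs q θ ⬝ᵥ f|) :
    entropyGain p q θ + α ^ 2 / 4 ≤ entropyGain p q (weightUpdate q α θ f v) := by
  have hα : 0 ≤ α := (abs_nonneg _).trans hv
  have hsign : |((SignType.sign (v - gibbs q θ ⬝ᵥ f) : SignType) : ℝ)| ≤ 1 := by
    cases SignType.sign (v - gibbs q θ ⬝ᵥ f) <;> simp
  have hstep (a : ι) : |((α / 2 * SignType.sign (v - gibbs q θ ⬝ᵥ f)) • f) a| ≤ α / 2 := by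
    rw [Pi.smul_apply, smul_eq_mul, abs_mul, abs_mul, abs_of_nonneg (by linarith : 0 ≤ α / 2),
      mul_assoc]
    exact mul_le_of_le_one_right (by linarith) (mul_le_one₀ hsign (abs_nonneg _) (hf a))
  have hgain := entropyGain_add_ge (p := p) (θ := θ) hq (by linarith) hstep
  have hdrift : α / 2 * α ≤ (p - gibbs q θ) ⬝ᵥ
      ((α / 2 * SignType.sign (v - gibbs q θ ⬝ᵥ f)) • f) := by
    rw [dotProduct_smul, smul_eq_mul, mul_assoc, sub_dotProduct]
    exact mul_le_mul_of_nonneg_left (le_sign_mul_of_two_mul_lt_abs hv htest) (by linarith)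
  rw [weightUpdate]
  linarith

end MultiplicativeWeights

section Hybrid

variable {ι : Type*}

/-- The product distribution on `κ → ι` with marginals `w`. -/
def productWeights {κ : Type*} [Fintype κ] (w : κ → ι → ℝ) : (κ → ι) → ℝ :=
  fun x => ∏ l, w l (x l)

section Product

variable {κ : Type*} [Fintype κ] {w w' : κ → ι → ℝ}

theorem productWeights_le_pow_mul (hw : ∀ l, 0 ≤ w l) {γ : ℝ} (h : ∀ l, w l ≤ γ • w' l)
    (x : κ → ι) : productWeights w x ≤ γ ^ Fintype.card κ * productWeights w' x :=
  calc productWeights w x ≤ ∏ l, γ * w' l (x l) :=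
        Finset.prod_le_prod (fun l _ => hw l (x l)) fun l _ => h l (x l)
    _ = γ ^ Fintype.card κ * productWeights w' x := by
        rw [Finset.prod_mul_distrib, Finset.prod_const, Finset.card_univ, productWeights]

theorem productWeights_mem_stdSimplex [Fintype ι] [DecidableEq κ]
    (hw : ∀ l, w l ∈ stdSimplex ℝ ι) : productWeights w ∈ stdSimplex ℝ (κ → ι) := by
  refine ⟨fun x => Finset.prod_nonneg fun l _ => (hw l).1 (x l), ?_⟩
  simp only [productWeights, ← Fintype.prod_sum]
  exact Finset.prod_eq_one fun l _ => (hw l).2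

end Product

variable {n : ℕ} {p q r : ι → ℝ}

/-- The unary function `y ↦ g (x₁, …, xᵢ₋₁, y, xᵢ₊₁, …, xₙ₊₁)` for `ω = (i, x)`. -/
def slice (g : (Fin (n + 1) → ι) → ℝ) (ω : Fin (n + 1) × (Fin n → ι)) : ι → ℝ :=
  fun y => g (ω.1.insertNth y ω.2)

/-- The marginals of the coordinates other than `i` in the hybrid argument: `r` before position
`i` and `p` after it. -/
def hybrid (p r : ι → ℝ) (i : Fin (n + 1)) : Fin n → ι → ℝ :=
  fun l => if l.castSucc < i then r else p

/-- The distribution of the pair `(i, x)` that determines a `slice`: a uniform position together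
with a sample of the other coordinates from the hybrid at that position. -/
noncomputable def sampleWeights (p r : ι → ℝ) (ω : Fin (n + 1) × (Fin n → ι)) : ℝ :=
  (n + 1 : ℝ)⁻¹ * productWeights (hybrid p r ω.1) ω.2

theorem insertNth_hybrid_left (p r : ι → ℝ) (i : Fin (n + 1)) :
    i.insertNth p (hybrid p r i) = fun l : Fin (n + 1) => if (l : ℕ) < i then r else p := by
  refine Fin.insertNth_eq_iff.2 ⟨by simp, funext fun l => ?_⟩
  simp only [hybrid, Fin.removeNth, ← Fin.lt_def, Fin.succAbove_lt_iff_castSucc_lt]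

theorem insertNth_hybrid_right (p r : ι → ℝ) (i : Fin (n + 1)) :
    i.insertNth r (hybrid p r i) = fun l : Fin (n + 1) => if (l : ℕ) < i + 1 then r else p := by
  refine Fin.insertNth_eq_iff.2 ⟨by simp, funext fun l => ?_⟩
  simp only [hybrid, Fin.removeNth, Nat.lt_succ_iff_lt_or_eq, ← Fin.lt_def,
    Fin.succAbove_lt_iff_castSucc_lt, Fin.val_inj, Fin.succAbove_ne, or_false]

theorem sampleWeights_le_pow_mul (hp : 0 ≤ p) (hr : 0 ≤ r) {γ : ℝ} (hγ : 1 ≤ γ)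
    (hpq : p ≤ γ • q) (ω : Fin (n + 1) × (Fin n → ι)) :
    sampleWeights p r ω ≤ γ ^ n * sampleWeights q r ω := by
  have hle := productWeights_le_pow_mul (w := hybrid p r ω.1) (w' := hybrid q r ω.1) (γ := γ)
    (fun l => by rw [hybrid]; split_ifs; exacts [hr, hp])
    (fun l => by
      simp only [hybrid]
      split_ifs
      exacts [fun a => le_mul_of_one_le_left (hr a) hγ, hpq]) ω.2
  rw [Fintype.card_fin] at hle
  rw [sampleWeights, sampleWeights, mul_left_comm]
  gcongr

variable [Fintype ι]

theorem productWeights_insertNth_dotProduct (i : Fin (n + 1)) (p : ι → ℝ) (w : Fin n → ι → ℝ)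
    (g : (Fin (n + 1) → ι) → ℝ) :
    productWeights (i.insertNth p w) ⬝ᵥ g =
      productWeights w ⬝ᵥ fun x => p ⬝ᵥ slice g (i, x) := by
  simp only [dotProduct, Finset.mul_sum, productWeights, slice]
  rw [← (Fin.insertNthEquiv (fun _ => ι) i).sum_comp, Fintype.sum_prod_type_right]
  refine Finset.sum_congr rfl fun x _ => Finset.sum_congr rfl fun y _ => ?_
  change _ * g (i.insertNth y x) = _
  simp only [Fin.insertNthEquiv_apply, Fin.prod_univ_succAbove _ i, Fin.insertNth_apply_same,
    Fin.insertNth_apply_succAbove]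
  ring

theorem productWeights_dotProduct_sub (p r : ι → ℝ) (g : (Fin (n + 1) → ι) → ℝ) :
    productWeights (fun _ => p) ⬝ᵥ g - productWeights (fun _ => r) ⬝ᵥ g =
      (n + 1) * (sampleWeights p r ⬝ᵥ fun ω => (p - r) ⬝ᵥ slice g ω) := by
  let W (j : ℕ) : Fin (n + 1) → ι → ℝ := fun l => if (l : ℕ) < j then r else p
  have hW0 : W 0 = fun _ => p := by simp [W]
  have hWn : W (n + 1) = fun _ => r := by simp only [W, Fin.is_lt, if_true]
  have hstep (i : Fin (n + 1)) : productWeights (W i) ⬝ᵥ g - productWeights (W (i + 1)) ⬝ᵥ g =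
      productWeights (hybrid p r i) ⬝ᵥ fun x => (p - r) ⬝ᵥ slice g (i, x) := by
    simp only [W, ← insertNth_hybrid_left, ← insertNth_hybrid_right,
      productWeights_insertNth_dotProduct, sub_dotProduct, ← dotProduct_sub]
    rfl
  rw [← hW0, ← hWn, ← Finset.sum_range_sub' (fun j => productWeights (W j) ⬝ᵥ g),
    Finset.sum_range, Finset.sum_congr rfl fun i _ => hstep i]
  simp only [dotProduct, sampleWeights, Fintype.sum_prod_type, Finset.mul_sum]
  field_simp

theorem hybrid_mem_stdSimplex (hp : p ∈ stdSimplex ℝ ι) (hr : r ∈ stdSimplex ℝ ι)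
    (i : Fin (n + 1)) (l : Fin n) : hybrid p r i l ∈ stdSimplex ℝ ι := by
  rw [hybrid]
  split_ifs
  exacts [hr, hp]

theorem sampleWeights_mem_stdSimplex (hp : p ∈ stdSimplex ℝ ι) (hr : r ∈ stdSimplex ℝ ι) :
    sampleWeights p r ∈ stdSimplex ℝ (Fin (n + 1) × (Fin n → ι)) := by
  have hprod (i : Fin (n + 1)) := productWeights_mem_stdSimplex (hybrid_mem_stdSimplex hp hr i)
  refine ⟨fun ω => mul_nonneg (by positivity) ((hprod ω.1).1 ω.2), ?_⟩
  simp only [sampleWeights, Fintype.sum_prod_type, ← Finset.mul_sum, (hprod _).2]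
  simp [Nat.cast_add_one_ne_zero n]

theorem abs_productWeights_dotProduct_sub_le (hp : p ∈ stdSimplex ℝ ι)
    (hr : r ∈ stdSimplex ℝ ι) {γ : ℝ} (hγ : 1 ≤ γ) (hpq : p ≤ γ • q)
    {g : (Fin (n + 1) → ι) → ℝ} (hg : ∀ x, |g x| ≤ 1) {β : ℝ} (hβ : 0 ≤ β) :
    |productWeights (fun _ => p) ⬝ᵥ g - productWeights (fun _ => r) ⬝ᵥ g| ≤
      (n + 1) * (β + 2 * γ ^ n *
        ∑ ω with β < |(p - r) ⬝ᵥ slice g ω|, sampleWeights q r ω) := by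
  have hw := sampleWeights_mem_stdSimplex (n := n) hp hr
  have hdiff (ω : Fin (n + 1) × (Fin n → ι)) : |(p - r) ⬝ᵥ slice g ω| ≤ 2 := by
    have h₁ := abs_dotProduct_le_of_mem_stdSimplex hp (f := slice g ω) fun a => hg _
    have h₂ := abs_dotProduct_le_of_mem_stdSimplex hr (f := slice g ω) fun a => hg _
    rw [sub_dotProduct]
    linarith [abs_sub (p ⬝ᵥ slice g ω) (r ⬝ᵥ slice g ω)]
  rw [productWeights_dotProduct_sub, abs_mul, abs_of_pos n.cast_add_one_pos]
  gcongr
  calc |sampleWeights p r ⬝ᵥ fun ω => (p - r) ⬝ᵥ slice g ω|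
      ≤ sampleWeights p r ⬝ᵥ fun ω => |(p - r) ⬝ᵥ slice g ω| := by
        refine (Finset.abs_sum_le_sum_abs _ _).trans_eq (Finset.sum_congr rfl fun ω _ => ?_)
        rw [abs_mul, abs_of_nonneg (hw.1 ω)]
    _ ≤ β + 2 * ∑ ω with β < |(p - r) ⬝ᵥ slice g ω|, sampleWeights p r ω :=
        dotProduct_le_add_mul_sum_filter hw hβ hdiff
    _ ≤ β + 2 * γ ^ n * ∑ ω with β < |(p - r) ⬝ᵥ slice g ω|, sampleWeights q r ω := by
        rw [mul_assoc, Finset.mul_sum _ _ (γ ^ n)]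
        gcongr with ω
        exact sampleWeights_le_pow_mul hp.1 hr.1 hγ hpq ω

end Hybrid

section PMF

theorem toOuterMeasure_compl {α : Type*} (P : PMF α) (s : Set α) :
    P.toOuterMeasure sᶜ = 1 - P.toOuterMeasure s := by
  let : MeasurableSpace α := ⊤
  simp only [← P.toMeasure_apply_eq_toOuterMeasure]
  exact prob_compl_eq_one_sub trivial

variable {ι : Type*} [Fintype ι]

/-- The probability mass function with weights `w`. -/
noncomputable def stdSimplexPMF (w : ι → ℝ) (hw : w ∈ stdSimplex ℝ ι) : PMF ι :=
  .ofFintype (fun a => ENNReal.ofReal (w a)) (by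
    rw [← ENNReal.ofReal_sum_of_nonneg fun a _ => hw.1 a, hw.2, ENNReal.ofReal_one])

theorem toOuterMeasure_stdSimplexPMF_compl_le {w : ι → ℝ} (hw : w ∈ stdSimplex ℝ ι)
    {s : Finset ι} {ρ : ℝ} (hs : ρ ≤ ∑ a ∈ s, w a) :
    (stdSimplexPMF w hw).toOuterMeasure (s : Set ι)ᶜ ≤ ENNReal.ofReal (1 - ρ) := by
  have hmass : (stdSimplexPMF w hw).toOuterMeasure s = ENNReal.ofReal (∑ a ∈ s, w a) := by
    rw [PMF.toOuterMeasure_apply_finset, ENNReal.ofReal_sum_of_nonneg fun a _ => hw.1 a]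
    rfl
  rw [toOuterMeasure_compl, hmass, ← ENNReal.ofReal_one,
    ← ENNReal.ofReal_sub _ (Finset.sum_nonneg fun a _ => hw.1 a)]
  exact ENNReal.ofReal_le_ofReal (sub_le_sub_left hs 1)

end PMF

namespace Algorithm

variable {X : Type*} [MeasurableSpace X] {k : ℕ}

/-- Draw from a distribution on a countable type. The primitive `draw` produces natural numbers, so
the elements are encoded; the continuation on numbers that are not codes is irrelevant. -/
noncomputable def drawFrom {α : Type*} [Countable α] (P : PMF α) (next : α → Algorithm X k) :
    Algorithm X k :=
  letI := Encodable.ofCountable α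
  draw (P.map Encodable.encode) fun m => (Encodable.decode m).elim (output 0) next

open Classical in
/-- Up to `t` times, draw a query and ask it; when an answer passes the test, go on with `next`.
If that never happens, output `r`. -/
noncomputable def searchStage {Ω : Type*} [Countable Ω] (P : PMF Ω) (Q : Ω → Query X k)
    (test : Ω → ℝ → Prop) (next : Ω → ℝ → Algorithm X k) (r : ℝ) : ℕ → Algorithm X k
  | 0 => output r
  | t + 1 => drawFrom P fun ω => ask (Q ω) fun v =>
      if test ω v then next ω v else searchStage P Q test next r t

/-- The probability that the output is not within `ε` of `a`, after the exchange `h`. -/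
noncomputable def errorProb (A : Algorithm X k) (O : Oracle X k) (h : List (Query X k × ℝ))
    (a ε : ℝ) : ENNReal :=
  (A.run O h).toOuterMeasure {r | ε < |r - a|}

section QueryCount

variable {m : ℕ}

theorem asksAtMost_output (r : ℝ) (m : ℕ) : (output r : Algorithm X k).AsksAtMost m := by
  cases m <;> trivial

theorem AsksAtMost.drawFrom {α : Type*} [Countable α] {P : PMF α} {next : α → Algorithm X k}
    (h : ∀ a, (next a).AsksAtMost m) : (drawFrom P next).AsksAtMost m := by
  let := Encodable.ofCountable α
  intro i
  change ((Encodable.decode (α := α) i).elim (output 0) next).AsksAtMost m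
  cases Encodable.decode (α := α) i with
  | none => exact asksAtMost_output 0 m
  | some a => exact h a

theorem asksAtMost_searchStage {Ω : Type*} [Countable Ω] {P : PMF Ω} {Q : Ω → Query X k}
    {test : Ω → ℝ → Prop} {next : Ω → ℝ → Algorithm X k} {r : ℝ}
    (hnext : ∀ ω v m', m ≤ m' → (next ω v).AsksAtMost m') (t : ℕ) {m' : ℕ} (hm : m + t ≤ m') :
    (searchStage P Q test next r t).AsksAtMost m' := by
  induction t generalizing m' with
  | zero => exact asksAtMost_output r m'
  | succ t ih =>
    obtain ⟨l, rfl⟩ : ∃ l, m' = l + 1 := ⟨m' - 1, by omega⟩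
    refine AsksAtMost.drawFrom fun ω v => ?_
    beta_reduce
    split_ifs
    · exact hnext ω v l (by omega)
    · exact ih (by omega)

end QueryCount

section ErrorProb

variable {O : Oracle X k} {h : List (Query X k × ℝ)} {a ε : ℝ}

theorem run_drawFrom {α : Type*} [Countable α] (P : PMF α) (next : α → Algorithm X k) :
    (drawFrom P next).run O h = P.bind fun b => (next b).run O h := by
  let := Encodable.ofCountable α
  rw [drawFrom, run, PMF.bind_map]
  congr 1
  funext b
  rw [Function.comp_apply, Encodable.encodek, Option.elim_some]

theorem errorProb_drawFrom {α : Type*} [Countable α] (P : PMF α) (next : α → Algorithm X k) :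
    (drawFrom P next).errorProb O h a ε = ∑' b, P b * (next b).errorProb O h a ε := by
  rw [errorProb, run_drawFrom, PMF.toOuterMeasure_bind_apply]
  rfl

theorem errorProb_ask (φ : Query X k) (next : ℝ → Algorithm X k) :
    (ask φ next).errorProb O h a ε =
      (next (O h φ)).errorProb O ((φ, O h φ) :: h) a ε := rfl

theorem errorProb_output {r : ℝ} (hr : |r - a| ≤ ε) : (output r).errorProb O h a ε = 0 := by
  rw [errorProb, run, PMF.toOuterMeasure_pure_apply, if_neg]
  exact hr.not_gt

theorem errorProb_le_one (A : Algorithm X k) : A.errorProb O h a ε ≤ 1 := by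
  rw [errorProb, ← compl_compl {r | ε < |r - a|}, toOuterMeasure_compl]
  exact tsub_le_self

theorem errorProb_le_of_abs_sub_le (A : Algorithm X k) {b η : ℝ} (h_ab : |a - b| ≤ η) :
    A.errorProb O h b (ε + η) ≤ A.errorProb O h a ε := by
  refine measure_mono fun r (hr : ε + η < |r - b|) => ?_
  change ε < |r - a|
  linarith [abs_sub_le r a b]

theorem estimates_of_errorProb_le {A : Algorithm X k} {δ : ℝ} (hδ : 0 ≤ δ)
    (hA : A.errorProb O [] a ε ≤ ENNReal.ofReal δ) : A.Estimates O a ε δ := by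
  have hcompl : {r : ℝ | |r - a| ≤ ε} = {r | ε < |r - a|}ᶜ := by ext; simp
  rw [Estimates, ENNReal.ofReal_sub _ hδ, ENNReal.ofReal_one, hcompl, toOuterMeasure_compl]
  exact tsub_le_tsub_left hA 1

variable {Ω : Type*} [Countable Ω] {P : PMF Ω} {Q : Ω → Query X k} {test : Ω → ℝ → Prop}
  {next : Ω → ℝ → Algorithm X k} {r : ℝ}

theorem errorProb_searchStage_le_of_abs_sub_le {β : ENNReal}
    (hnext : ∀ ω h h', test ω (O h (Q ω)) → (next ω (O h (Q ω))).errorProb O h' a ε ≤ β)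
    (hr : |r - a| ≤ ε) (t : ℕ) : (searchStage P Q test next r t).errorProb O h a ε ≤ β := by
  induction t generalizing h with
  | zero => rw [searchStage, errorProb_output hr]; exact zero_le
  | succ t ih =>
    rw [searchStage, errorProb_drawFrom]
    calc _ ≤ ∑' ω, P ω * β := by
          refine ENNReal.tsum_le_tsum fun ω => mul_le_mul_right ?_ _
          rw [errorProb_ask]
          split_ifs with htest
          · exact hnext _ _ _ htest
          · exact ih
      _ = β := by rw [ENNReal.tsum_mul_right, PMF.tsum_coe, one_mul]

theorem errorProb_searchStage_le_pow_add {β σ : ENNReal} {B : Set Ω}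
    (hnext : ∀ ω h h', test ω (O h (Q ω)) → (next ω (O h (Q ω))).errorProb O h' a ε ≤ β)
    (hB : ∀ ω ∈ B, ∀ h, test ω (O h (Q ω))) (hP : P.toOuterMeasure Bᶜ ≤ σ) (t : ℕ) :
    (searchStage P Q test next r t).errorProb O h a ε ≤ σ ^ t + β := by
  induction t generalizing h with
  | zero => rw [pow_zero]; exact (errorProb_le_one _).trans le_self_add
  | succ t ih =>
    rw [searchStage, errorProb_drawFrom]
    calc _ ≤ ∑' ω, (Bᶜ.indicator P ω * σ ^ t + P ω * β) := by
          refine ENNReal.tsum_le_tsum fun ω => ?_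
          rw [errorProb_ask]
          by_cases hω : ω ∈ B
          · rw [if_pos (hB ω hω h), Set.indicator_of_notMem (Set.notMem_compl_iff.2 hω),
              zero_mul, zero_add]
            exact mul_le_mul_right (hnext _ _ _ (hB ω hω h)) _
          · rw [Set.indicator_of_mem (Set.mem_compl hω), ← mul_add]
            refine mul_le_mul_right ?_ _
            split_ifs with htest
            · exact (hnext _ _ _ htest).trans le_add_self
            · exact ih
      _ = P.toOuterMeasure Bᶜ * σ ^ t + β := by
          rw [ENNReal.tsum_add, ENNReal.tsum_mul_right, ENNReal.tsum_mul_right, PMF.tsum_coe,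
            one_mul, PMF.toOuterMeasure_apply]
      _ ≤ σ ^ (t + 1) + β := by
          rw [pow_succ']
          gcongr

end ErrorProb

end Algorithm

section Search

variable {ι : Type*} [Fintype ι] {n : ℕ} {X : Type*} [MeasurableSpace X]

/-- Multiplicative weights search for weights `gibbs q θ` whose product has the same mean of `g` as
that of the unknown distribution. There are `u` stages, each with at most `t` queries; a stage looks
for a slice of `g` whose mean is off by more than `2 * α`, the query `Q ω` being supposed to have
the mean of `slice g ω`. -/
noncomputable def search {q : ι → ℝ} (hq : q ∈ stdSimplex ℝ ι) (g : (Fin (n + 1) → ι) → ℝ)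
    (Q : Fin (n + 1) × (Fin n → ι) → Query X 1) (α : ℝ) (t : ℕ) :
    ℕ → (ι → ℝ) → Algorithm X 1
  | 0, _ => .output 0
  | u + 1, θ => .searchStage
      (stdSimplexPMF (sampleWeights q (gibbs q θ))
        (sampleWeights_mem_stdSimplex hq (gibbs_mem_stdSimplex hq)))
      Q (fun ω v => 2 * α < |v - gibbs q θ ⬝ᵥ slice g ω|)
      (fun ω v => search hq g Q α t u (weightUpdate q α θ (slice g ω) v))
      (productWeights (fun _ => gibbs q θ) ⬝ᵥ g) t

variable {p q r : ι → ℝ} {g : (Fin (n + 1) → ι) → ℝ} {Q : Fin (n + 1) × (Fin n → ι) → Query X 1}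
  {α : ℝ} {t : ℕ}

theorem asksAtMost_search (hq : q ∈ stdSimplex ℝ ι) (u : ℕ) (θ : ι → ℝ) {m : ℕ}
    (hm : u * t ≤ m) : (search hq g Q α t u θ).AsksAtMost m := by
  induction u generalizing θ m with
  | zero => exact Algorithm.asksAtMost_output 0 m
  | succ u ih =>
    exact Algorithm.asksAtMost_searchStage (fun _ _ _ hm' => ih _ hm') t
      ((Nat.succ_mul u t).symm.trans_le hm)

theorem two_mul_lt_abs_sub_dotProduct {f : ι → ℝ} {v : ℝ} (hv : |v - p ⬝ᵥ f| ≤ α)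
    (hf : 3 * α < |(p - r) ⬝ᵥ f|) : 2 * α < |v - r ⬝ᵥ f| := by
  rw [sub_dotProduct] at hf
  rw [abs_sub_comm] at hv
  linarith [abs_sub_le (p ⬝ᵥ f) v (r ⬝ᵥ f)]

theorem le_sum_sampleWeights (hp : p ∈ stdSimplex ℝ ι) (hr : r ∈ stdSimplex ℝ ι) {γ : ℝ}
    (hγ : 1 ≤ γ) (hpq : p ≤ γ • q) (hg : ∀ x, |g x| ≤ 1) {β ε ρ : ℝ} (hβ : 0 ≤ β)
    (hρ : (n + 1) * (β + 2 * γ ^ n * ρ) ≤ ε)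
    (hε : ε < |productWeights (fun _ => r) ⬝ᵥ g - productWeights (fun _ => p) ⬝ᵥ g|) :
    ρ ≤ ∑ ω with β < |(p - r) ⬝ᵥ slice g ω|, sampleWeights q r ω := by
  by_contra! hlt
  rw [abs_sub_comm] at hε
  refine hε.not_ge ((abs_productWeights_dotProduct_sub_le hp hr hγ hpq hg hβ).trans
    (le_trans ?_ hρ))
  gcongr

theorem errorProb_search_le {O : Oracle X 1} (hO : ∀ h ω, |O h (Q ω) - p ⬝ᵥ slice g ω| ≤ α)
    (hp : p ∈ stdSimplex ℝ ι) (hq : q ∈ stdSimplex ℝ ι) {γ : ℝ} (hγ : 1 ≤ γ) (hpq : p ≤ γ • q)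
    (hg : ∀ x, |g x| ≤ 1) (hα : 0 ≤ α) (hα1 : α ≤ 1) {ε ρ : ℝ}
    (hρ : (n + 1) * (3 * α + 2 * γ ^ n * ρ) ≤ ε) (u : ℕ) {θ : ι → ℝ}
    (hθ : Real.log γ < entropyGain p q θ + u * (α ^ 2 / 4)) (h : List (Query X 1 × ℝ)) :
    (search hq g Q α t u θ).errorProb O h (productWeights (fun _ => p) ⬝ᵥ g) ε ≤
      u * ENNReal.ofReal (1 - ρ) ^ t := by
  induction u generalizing θ h with
  | zero =>
    rw [Nat.cast_zero, zero_mul, add_zero] at hθ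
    exact absurd (entropyGain_le hp hpq) hθ.not_ge
  | succ u ih =>
    have hr := gibbs_mem_stdSimplex (θ := θ) hq
    have hnext (ω) (h h' : List (Query X 1 × ℝ))
        (htest : 2 * α < |O h (Q ω) - gibbs q θ ⬝ᵥ slice g ω|) :=
      ih (θ := weightUpdate q α θ (slice g ω) (O h (Q ω))) (by
        have hgain := entropyGain_weightUpdate hq (f := slice g ω) (fun a => hg _) hα1
          (hO h ω) htest
        push_cast at hθ
        linarith) h'
    rw [search, Nat.cast_succ, add_mul, one_mul]
    by_cases hgood : |productWeights (fun _ => gibbs q θ) ⬝ᵥ g -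
        productWeights (fun _ => p) ⬝ᵥ g| ≤ ε
    · exact (Algorithm.errorProb_searchStage_le_of_abs_sub_le hnext hgood t).trans le_self_add
    · have hmass := le_sum_sampleWeights hp hr hγ hpq hg (by positivity) hρ (not_le.1 hgood)
      rw [add_comm (u * _ : ENNReal)]
      refine Algorithm.errorProb_searchStage_le_pow_add hnext (fun ω hω h => ?_)
        (toOuterMeasure_stdSimplexPMF_compl_le _ hmass) t
      exact two_mul_lt_abs_sub_dotProduct (hO h ω) (by simpa using hω)

end Search

section Query

variable {X : Type*} [MeasurableSpace X] {k : ℕ}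

theorem le_toNNReal_smul {μ ν : Measure X} [IsFiniteMeasure μ] [IsFiniteMeasure ν] {γ : ℝ}
    (hγ : 0 ≤ γ) (h : ∀ E, MeasurableSet E → μ.real E ≤ γ * ν.real E) : μ ≤ γ.toNNReal • ν := by
  refine Measure.le_iff.2 fun E hE => ?_
  rw [← ENNReal.toReal_le_toReal (measure_ne_top _ _) (measure_ne_top _ _)]
  change μ.real E ≤ (γ.toNNReal • ν).real E
  rw [measureReal_nnreal_smul_apply, Real.coe_toNNReal γ hγ]
  exact h E hE

namespace Query

theorem integrable (φ : Query X k) (μ : Measure (Fin k → X)) [IsFiniteMeasure μ] :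
    Integrable φ.toFun μ :=
  .of_mem_Icc (-1) 1 φ.measurable.aemeasurable (.of_forall φ.mem_Icc)

theorem abs_mean_le_one (φ : Query X k) (D : ProbabilityMeasure X) : |φ.mean D| ≤ 1 := by
  simpa [mean] using norm_integral_le_of_norm_le_const (f := φ.toFun)
    (μ := Measure.pi fun _ => (D : Measure X)) (.of_forall fun x => abs_le.2 (φ.mem_Icc x))

theorem abs_mean_sub_mean_le (φ ψ : Query X k) {D ν : ProbabilityMeasure X} {c : NNReal}
    (h : (D : Measure X) ≤ c • (ν : Measure X)) :
    |φ.mean D - ψ.mean D| ≤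
      c ^ k * ∫ x, |φ.toFun x - ψ.toFun x| ∂(Measure.pi fun _ => (ν : Measure X)) := by
  rw [mean, mean, ← integral_sub (φ.integrable _) (ψ.integrable _)]
  refine abs_integral_le_integral_abs.trans ?_
  have hle := integral_pi_le_pow_mul (fun _ : Fin k => h)
    ((φ.integrable _).sub (ψ.integrable _)).abs fun x => abs_nonneg _
  rwa [Fintype.card_fin] at hle

end Query

end Query

section Cells

variable {X : Type*} [MeasurableSpace X] {ι : Type*} [Fintype ι] {π : X → ι}

/-- The discretization of `μ` to the partition of `X` into the fibres of `π`: the weight of a cell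
is its measure. -/
def cellWeights (μ : Measure X) (π : X → ι) : ι → ℝ := fun a => μ.real (π ⁻¹' {a})

variable [MeasurableSpace ι] [MeasurableSingletonClass ι]

theorem cellWeights_mem_stdSimplex (μ : Measure X) [IsProbabilityMeasure μ] (hπ : Measurable π) :
    cellWeights μ π ∈ stdSimplex ℝ ι := by
  refine ⟨fun a => measureReal_nonneg, ?_⟩
  simp only [cellWeights]
  rw [sum_measureReal_preimage_singleton _ fun a _ => hπ (measurableSet_singleton a),
    Finset.coe_univ, Set.preimage_univ, probReal_univ]

theorem integral_comp_eq_productWeights_dotProduct {κ : Type*} [Fintype κ] [DecidableEq κ]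
    (μ : Measure X) [IsFiniteMeasure μ] (hπ : Measurable π) (g : (κ → ι) → ℝ) :
    ∫ x, g (π ∘ x) ∂(Measure.pi fun _ => μ) = productWeights (fun _ => cellWeights μ π) ⬝ᵥ g := by
  have hm : Measurable fun x : κ → X => π ∘ x :=
    measurable_pi_lambda _ fun i => hπ.comp (measurable_pi_apply i)
  have hmap : (Measure.pi fun _ : κ => μ).map (fun x => π ∘ x) = Measure.pi fun _ => μ.map π :=
    Measure.pi_map_pi fun _ => hπ.aemeasurable
  rw [← integral_map (f := g) hm.aemeasurable (measurable_of_finite g).aestronglyMeasurable, hmap,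
    integral_fintype .of_finite]
  refine Finset.sum_congr rfl fun y _ => ?_
  rw [smul_eq_mul, measureReal_def, Measure.pi_singleton, ENNReal.toReal_prod]
  simp only [Measure.map_apply hπ (measurableSet_singleton _)]
  rfl

/-- The query that evaluates `g` at the cells of the samples. -/
def gridQuery {k : ℕ} (hπ : Measurable π) (g : (Fin k → ι) → ℝ) (hg : ∀ y, |g y| ≤ 1) :
    Query X k where
  toFun x := g (π ∘ x)
  measurable := (measurable_of_finite g).comp
    (measurable_pi_lambda _ fun i => hπ.comp (measurable_pi_apply i))
  mem_Icc _ := abs_le.1 (hg _)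

variable (hπ : Measurable π) (D : ProbabilityMeasure X)

theorem mean_gridQuery {k : ℕ} {g : (Fin k → ι) → ℝ} (hg : ∀ y, |g y| ≤ 1) :
    (gridQuery hπ g hg).mean D =
      productWeights (fun _ => cellWeights (D : Measure X) π) ⬝ᵥ g :=
  integral_comp_eq_productWeights_dotProduct (D : Measure X) hπ g

theorem mean_gridQuery_unary {f : ι → ℝ} (hf : ∀ a, |f a| ≤ 1) :
    (gridQuery hπ (fun y : Fin 1 → ι => f (y 0)) fun _ => hf _).mean D =
      cellWeights (D : Measure X) π ⬝ᵥ f := by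
  rw [mean_gridQuery, dotProduct, ← (Equiv.funUnique (Fin 1) ι).symm.sum_comp]
  simp [productWeights, dotProduct]

end Cells

section Parameters

/-- A number of stages that the search cannot exceed: each of them increases the entropy gain, which
is at most `log γ`, by `α ^ 2 / 4`. -/
noncomputable def stageCount (γ α : ℝ) : ℕ := ⌊Real.log γ / (α ^ 2 / 4)⌋₊ + 1

/-- The number of trials in each of `u` stages such that, when a trial succeeds with probability at
least `ρ`, some stage fails with probability at most `δ`. -/
noncomputable def trialCount (u ρ δ : ℝ) : ℕ := ⌈Real.log (u / δ) / ρ⌉₊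

/-- The bound on the number of queries, in terms of the quantity `F` of the theorem. -/
noncomputable def queryBound (F δ : ℝ) : ℝ :=
  6525 * (F * max 1 (Real.log (1 / δ))) * Real.log (2 + F) ^ 2

variable {γ α u ρ δ K L F G : ℝ}

theorem log_lt_stageCount_mul (hα : 0 < α) : Real.log γ < stageCount γ α * (α ^ 2 / 4) := by
  rw [← div_lt_iff₀ (by positivity), stageCount, Nat.cast_succ]
  exact Nat.lt_floor_add_one _

theorem mul_pow_trialCount_le (hu : 0 < u) (hρ : 0 < ρ) (hρ1 : ρ ≤ 1) (hδ : 0 < δ) :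
    u * (1 - ρ) ^ trialCount u ρ δ ≤ δ :=
  calc u * (1 - ρ) ^ trialCount u ρ δ ≤ u * Real.exp (-ρ) ^ trialCount u ρ δ := by
        have := sub_nonneg.2 hρ1
        gcongr
        exact Real.one_sub_le_exp_neg ρ
    _ = u * Real.exp (-(trialCount u ρ δ * ρ)) := by rw [← Real.exp_nat_mul, mul_neg]
    _ ≤ u * Real.exp (-Real.log (u / δ)) := by
        gcongr
        exact (div_le_iff₀ hρ).1 (Nat.le_ceil _)
    _ = δ := by
        rw [Real.exp_neg, Real.exp_log (div_pos hu hδ), inv_div, mul_div_cancel₀ _ hu.ne']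

theorem one_le_log_two_add (hF : 1 ≤ F) : 1 ≤ Real.log (2 + F) := by
  rw [Real.le_log_iff_exp_le (by linarith)]
  linarith [Real.exp_one_lt_d9]

theorem stageCount_le (hγ : 1 ≤ γ) (hK : 1 ≤ K) (hL : 1 ≤ L) (hγL : Real.log γ ≤ L) :
    stageCount γ (6 * K)⁻¹ ≤ 145 * (K ^ 2 * L) := by
  have hlog := Real.log_nonneg hγ
  have hKL : 1 ≤ K ^ 2 * L := one_le_mul_of_one_le_of_one_le (one_le_pow₀ hK) hL
  have hfloor := Nat.floor_le (div_nonneg hlog (by positivity : 0 ≤ (6 * K)⁻¹ ^ 2 / 4))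
  have hstage : Real.log γ / ((6 * K)⁻¹ ^ 2 / 4) ≤ 144 * (K ^ 2 * L) :=
    calc Real.log γ / ((6 * K)⁻¹ ^ 2 / 4) = 144 * (K ^ 2 * Real.log γ) := by field_simp; ring
      _ ≤ 144 * (K ^ 2 * L) := by gcongr
  rw [stageCount, Nat.cast_succ]
  linarith

theorem log_le_seven_mul_log (hu : 0 < u) (hF : 1 ≤ F)
    (huF : u ≤ 145 * (F * Real.log (2 + F))) : Real.log u ≤ 7 * Real.log (2 + F) := by
  have hlog0 : 0 ≤ Real.log (2 + F) := Real.log_nonneg (by linarith)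
  have hlog : Real.log (2 + F) ≤ 2 + F := Real.log_le_self (by linarith)
  have h145 : (145 : ℝ) ≤ (2 + F) ^ 5 :=
    (by norm_num : (145 : ℝ) ≤ 3 ^ 5).trans (by gcongr; linarith)
  calc Real.log u ≤ Real.log ((2 + F) ^ 7) := by
        refine Real.log_le_log hu (huF.trans ?_)
        calc 145 * (F * Real.log (2 + F)) ≤ (2 + F) ^ 5 * ((2 + F) * (2 + F)) := by
              gcongr
              linarith only
          _ = (2 + F) ^ 7 := by ring
    _ = 7 * Real.log (2 + F) := by rw [Real.log_pow]; norm_num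

theorem trialCount_le {c : ℝ} (hu : 0 < u) (hρ : 0 < ρ) (hρ1 : ρ ≤ 1) (hδ : 0 < δ) (hL : 1 ≤ L)
    (hc : 0 ≤ c) (huL : Real.log u ≤ c * L) :
    trialCount u ρ δ ≤ (c + 2) * (L * max 1 (Real.log (1 / δ)) / ρ) := by
  set m := max 1 (Real.log (1 / δ))
  have hm1 : 1 ≤ m := le_max_left _ _
  have hlog : Real.log (u / δ) ≤ (c + 1) * (L * m) := by
    have h₁ : c * L ≤ c * (L * m) := by gcongr; exact le_mul_of_one_le_right (by linarith) hm1
    have h₂ : m ≤ L * m := le_mul_of_one_le_left (by linarith) hL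
    rw [div_eq_mul_one_div, Real.log_mul hu.ne' (by positivity)]
    linarith [le_max_right 1 (Real.log (1 / δ))]
  have hone : 1 ≤ L * m / ρ := by
    rw [one_le_div hρ]
    exact hρ1.trans (one_le_mul_of_one_le_of_one_le hL hm1)
  have hceil : (trialCount u ρ δ : ℝ) ≤ (c + 1) * (L * m) / ρ + 1 :=
    calc (trialCount u ρ δ : ℝ) ≤ ⌈(c + 1) * (L * m) / ρ⌉₊ := by
          rw [trialCount]
          gcongr
      _ ≤ (c + 1) * (L * m) / ρ + 1 := (Nat.ceil_lt_add_one (by positivity)).le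
  rw [mul_div_assoc] at hceil
  linarith

theorem stageCount_mul_trialCount_le (hK : 1 ≤ K) (hγ : 1 ≤ γ) (hγG : γ ≤ G) (hδ : 0 < δ) :
    stageCount γ (6 * K)⁻¹ * trialCount (stageCount γ (6 * K)⁻¹) (5 * K * G)⁻¹ δ ≤
      queryBound (G * K ^ 3) δ := by
  have hG : 1 ≤ G := hγ.trans hγG
  have hF : 1 ≤ G * K ^ 3 := one_le_mul_of_one_le_of_one_le hG (one_le_pow₀ hK)
  have hL := one_le_log_two_add hF
  have hγL : Real.log γ ≤ Real.log (2 + G * K ^ 3) := by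
    gcongr
    linarith [le_mul_of_one_le_right (by linarith : 0 ≤ G) (one_le_pow₀ (n := 3) hK)]
  have hKF : K ^ 2 ≤ G * K ^ 3 :=
    (pow_le_pow_right₀ hK (by norm_num)).trans (le_mul_of_one_le_left (by positivity) hG)
  have hpos : (0 : ℝ) < stageCount γ (6 * K)⁻¹ := Nat.cast_pos.2 (Nat.succ_pos _)
  have hstage := stageCount_le hγ hK hL hγL
  have hρ1 : (5 * K * G)⁻¹ ≤ 1 := inv_le_one_of_one_le₀
    (one_le_mul_of_one_le_of_one_le (by linarith) hG)
  have htrial := trialCount_le hpos (by positivity) hρ1 hδ hL (by norm_num)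
    (log_le_seven_mul_log hpos hF (hstage.trans (by gcongr)))
  calc _ ≤ 145 * (K ^ 2 * Real.log (2 + G * K ^ 3)) * _ := mul_le_mul hstage htrial
        (by positivity) (by positivity)
    _ = queryBound (G * K ^ 3) δ := by
        rw [queryBound, div_inv_eq_mul]
        ring

theorem queryBound_nonneg (hF : 0 ≤ F) : 0 ≤ queryBound F δ := by
  rw [queryBound]
  positivity

theorem one_le_queryBound (hF : 1 ≤ F) : 1 ≤ queryBound F δ := by
  have hFm := one_le_mul_of_one_le_of_one_le hF (le_max_left 1 (Real.log (1 / δ)))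
  exact one_le_mul_of_one_le_of_one_le (by linarith) (one_le_pow₀ (one_le_log_two_add hF))

end Parameters

section Estimation

variable {X : Type*} [MeasurableSpace X]

theorem exists_gridQuery_abs_mean_sub_le {k : ℕ} (ν : ProbabilityMeasure X) (c : NNReal)
    (φ : Query X k) {ε : ℝ} (hε : 0 < ε) :
    ∃ (m : ℕ) (π : X → Fin m) (hπ : Measurable π) (g : (Fin k → Fin m) → ℝ)
      (hg : ∀ y, |g y| ≤ 1), ∀ D : ProbabilityMeasure X, (D : Measure X) ≤ c • (ν : Measure X) →
        |φ.mean D - (gridQuery hπ g hg).mean D| ≤ ε := by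
  obtain ⟨m, π, g, hπ, hg, hφg⟩ := IsGridFunction.exists_mem_Icc_integral_abs_sub_le
    (Measure.pi fun _ => (ν : Measure X)) φ.measurable (by norm_num) φ.mem_Icc
    (ε := ε / (c ^ k + 1)) (by positivity)
  refine ⟨m, π, hπ, g, fun y => abs_le.2 (hg y), fun D hD => ?_⟩
  calc |φ.mean D - (gridQuery hπ g _).mean D| ≤ c ^ k * (ε / (c ^ k + 1)) :=
        (φ.abs_mean_sub_mean_le _ hD).trans (by gcongr; exact hφg)
    _ ≤ ε := by
        rw [mul_div_left_comm]
        exact mul_le_of_le_one_right hε.le ((div_le_one (by positivity)).2 (by linarith))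

theorem errorProb_search_le_ofReal {ι : Type*} [Fintype ι] {n : ℕ} {p q : ι → ℝ}
    {g : (Fin (n + 1) → ι) → ℝ} {Q : Fin (n + 1) × (Fin n → ι) → Query X 1} {O : Oracle X 1}
    {γ δ K : ℝ} (hK : 1 ≤ K) (hO : ∀ h ω, |O h (Q ω) - p ⬝ᵥ slice g ω| ≤ (6 * K)⁻¹)
    (hp : p ∈ stdSimplex ℝ ι) (hq : q ∈ stdSimplex ℝ ι) (hγ : 1 ≤ γ) (hpq : p ≤ γ • q)
    (hg : ∀ x, |g x| ≤ 1) (hδ : 0 < δ) :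
    (search hq g Q (6 * K)⁻¹ (trialCount (stageCount γ (6 * K)⁻¹) (5 * K * γ ^ n)⁻¹ δ)
        (stageCount γ (6 * K)⁻¹) 0).errorProb O [] (productWeights (fun _ => p) ⬝ᵥ g)
      (9 / 10 * ((n + 1) / K)) ≤ ENNReal.ofReal δ := by
  have hα : 0 < (6 * K)⁻¹ := by positivity
  have hρ1 : (5 * K * γ ^ n)⁻¹ ≤ 1 := inv_le_one_of_one_le₀
    (one_le_mul_of_one_le_of_one_le (by linarith) (one_le_pow₀ hγ))
  have hgain : Real.log γ <
      entropyGain p q 0 + stageCount γ (6 * K)⁻¹ * ((6 * K)⁻¹ ^ 2 / 4) := by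
    rw [entropyGain_zero hq, zero_add]
    exact log_lt_stageCount_mul hα
  have hprecision : (n + 1) * (3 * (6 * K)⁻¹ + 2 * γ ^ n * (5 * K * γ ^ n)⁻¹) ≤
      9 / 10 * ((n + 1) / K) := le_of_eq (by field_simp; ring)
  refine (errorProb_search_le hO hp hq hγ hpq hg hα.le (inv_le_one_of_one_le₀ (by linarith))
    hprecision _ hgain []).trans ?_
  rw [← ENNReal.ofReal_pow (sub_nonneg.2 hρ1), ← ENNReal.ofReal_natCast,
    ← ENNReal.ofReal_mul (by positivity)]
  exact ENNReal.ofReal_le_ofReal (mul_pow_trialCount_le (Nat.cast_pos.2 (Nat.succ_pos _))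
    (by positivity) hρ1 hδ)

theorem exists_search_estimates {𝒟 : Set (ProbabilityMeasure X)} {γ : ℝ} (hγ : 1 ≤ γ)
    (h𝒟 : IsFlat γ 𝒟) {n : ℕ} {K δ : ℝ} (hK : 1 ≤ K) (hδ : 0 < δ) (φ : Query X (n + 1)) :
    ∃ A : Algorithm X 1,
      A.AsksAtMost (stageCount γ (6 * K)⁻¹ *
        trialCount (stageCount γ (6 * K)⁻¹) (5 * K * γ ^ n)⁻¹ δ) ∧
      ∀ D ∈ 𝒟, ∀ O : Oracle X 1, IsSTAT D (6 * K)⁻¹ O →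
        A.Estimates O (φ.mean D) ((n + 1) / K) δ := by
  obtain ⟨ν, hν⟩ := h𝒟
  obtain ⟨m, π, hπ, g, hg, hφg⟩ := exists_gridQuery_abs_mean_sub_le ν γ.toNNReal φ
    (by positivity : 0 < 1 / 10 * ((n + 1) / K))
  have hq := cellWeights_mem_stdSimplex (ν : Measure X) hπ
  refine ⟨search hq g (fun ω => gridQuery hπ (fun y => slice g ω (y 0)) fun _ => hg _) (6 * K)⁻¹ _
    _ 0, asksAtMost_search hq _ _ le_rfl, fun D hD O hO => ?_⟩
  have hclose := hφg D (le_toNNReal_smul (by linarith) (hν D hD))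
  rw [mean_gridQuery, abs_sub_comm] at hclose
  have hpq : cellWeights (D : Measure X) π ≤ γ • cellWeights (ν : Measure X) π :=
    fun a => hν D hD _ (hπ (measurableSet_singleton a))
  have herror := errorProb_search_le_ofReal hK
    (fun h ω => mean_gridQuery_unary hπ D (f := slice g ω) (fun _ => hg _) ▸ hO h _)
    (cellWeights_mem_stdSimplex (D : Measure X) hπ) hq hγ hpq hg hδ
  have hprecision : 9 / 10 * ((n + 1) / K) + 1 / 10 * ((n + 1) / K) = (n + 1) / K := by ring
  rw [← hprecision]
  exact Algorithm.estimates_of_errorProb_le hδ.le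
    ((Algorithm.errorProb_le_of_abs_sub_le _ hclose).trans herror)

section Estimates

variable {k : ℕ} {D : ProbabilityMeasure X} {O : Oracle X 1} {τ δ : ℝ}

theorem estimates_output_zero (φ : Query X k) (hτ : 1 ≤ τ) (hδ : 0 ≤ δ) :
    (Algorithm.output 0).Estimates O (φ.mean D) τ δ := by
  refine Algorithm.estimates_of_errorProb_le hδ ?_
  rw [Algorithm.errorProb_output]
  · exact zero_le
  · rw [zero_sub, abs_neg]
    exact (φ.abs_mean_le_one D).trans hτ

theorem estimates_ask_output (φ : Query X 1) (hO : IsSTAT D τ O) (hδ : 0 ≤ δ) :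
    (Algorithm.ask φ .output).Estimates O (φ.mean D) τ δ := by
  refine Algorithm.estimates_of_errorProb_le hδ ?_
  rw [Algorithm.errorProb_ask, Algorithm.errorProb_output (hO _ _)]
  exact zero_le

end Estimates

theorem IsSTAT.mono {k : ℕ} {D : ProbabilityMeasure X} {τ τ' : ℝ} {O : Oracle X k}
    (hO : IsSTAT D τ O) (hτ : τ ≤ τ') : IsSTAT D τ' O := fun h φ => (hO h φ).trans hτ

theorem exists_algorithm_estimates {𝒟 : Set (ProbabilityMeasure X)} {γ τ δ : ℝ} {k : ℕ} (hγ : 1 ≤ γ)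
    (hτ : 0 < τ) (hk : 0 < k) (h𝒟 : IsFlat γ 𝒟) (hδ : 0 < δ) (φ : Query X k) :
    ∃ A : Algorithm X 1,
      (∃ q : ℕ, A.AsksAtMost q ∧ q ≤ queryBound (γ ^ (k - 1) * (k : ℝ) ^ 3 / τ ^ 3) δ) ∧
      ∀ D ∈ 𝒟, ∀ O : Oracle X 1, IsSTAT D (τ / (6 * k)) O → A.Estimates O (φ.mean D) τ δ := by
  rcases lt_or_ge 1 τ with hτ1 | hτ1
  · refine ⟨.output 0, ⟨0, trivial, ?_⟩, fun D _ O _ => estimates_output_zero φ hτ1.le hδ.le⟩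
    rw [Nat.cast_zero]
    exact queryBound_nonneg (by positivity)
  obtain ⟨n, rfl⟩ := Nat.exists_eq_add_one.2 hk
  rw [Nat.add_sub_cancel]
  rcases n.eq_zero_or_pos with rfl | hn
  · refine ⟨.ask φ .output, ⟨1, fun _ => trivial, ?_⟩, fun D _ O hO =>
      estimates_ask_output φ (hO.mono (div_le_self hτ.le (by norm_num))) hδ.le⟩
    rw [Nat.cast_one]
    refine one_le_queryBound ?_
    simpa using (one_le_inv₀ (pow_pos hτ 3)).2 (pow_le_one₀ hτ.le hτ1)
  · have hK : 1 ≤ (n + 1) / τ := (one_le_div hτ).2 (hτ1.trans (by simp))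
    obtain ⟨A, hA, hest⟩ := exists_search_estimates hγ h𝒟 hK hδ φ
    refine ⟨A, ⟨_, hA, ?_⟩, fun D hD O hO => ?_⟩
    · have hbound := stageCount_mul_trialCount_le hK hγ (le_self_pow₀ hγ hn.ne') hδ
      rw [div_pow, ← mul_div_assoc (γ ^ n)] at hbound
      push_cast
      exact hbound
    · have hscale : (n + 1 : ℝ) / ((n + 1) / τ) = τ := div_div_cancel₀ (by positivity)
      have htol : τ / (6 * ↑(n + 1)) = (6 * ((n + 1 : ℝ) / τ))⁻¹ := by
        push_cast
        field_simp
      exact hscale ▸ hest D hD O (htol ▸ hO)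

end Estimation

end SQ

theorem theorem2 :
    ∃ (C : ℝ) (c : ℕ), 0 < C ∧
      ∀ (X : Type u) [MeasurableSpace X] (𝒟 : Set (ProbabilityMeasure X)) (γ τ : ℝ) (k : ℕ),
        1 ≤ γ → 0 < τ → 0 < k → SQ.IsFlat γ 𝒟 →
        ∃ A : ℝ → SQ.Query X k → SQ.Algorithm X 1,
          ∀ (δ : ℝ) (φ : SQ.Query X k), 0 < δ →
            (∃ q : ℕ, (A δ φ).AsksAtMost q ∧
              (q : ℝ) ≤ C * (γ ^ (k - 1) * (k : ℝ) ^ 3 / τ ^ 3 * max 1 (Real.log (1 / δ))) *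
                Real.log (2 + γ ^ (k - 1) * (k : ℝ) ^ 3 / τ ^ 3) ^ c) ∧
            ∀ D ∈ 𝒟, ∀ O : SQ.Oracle X 1, SQ.IsSTAT D (τ / (6 * k)) O →
              (A δ φ).Estimates O (φ.mean D) τ δ := by
  refine ⟨6525, 2, by norm_num, fun X _ 𝒟 γ τ k hγ hτ hk h𝒟 => ?_⟩
  have : Nonempty (SQ.Algorithm X 1) := ⟨.output 0⟩
  have hA (δ : ℝ) (φ : SQ.Query X k) (hδ : 0 < δ) := SQ.exists_algorithm_estimates hγ hτ hk h𝒟 hδ φ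
  choose! A hA using hA
  exact ⟨A, hA⟩
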